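/- Let $A$ be a unital $C^*$-algebra and let $E$ be a countably generated Hilbert $C^*$-module over $A$. Write $L(E)$ for the bounded adjointable operators on $E$ and $K(F,E)$ for the compact operators $F\to E$ between Hilbert $A$-modules, i.e. the operator-norm limits of finite sums of operators $z\mapsto x\langle y,z\rangle$ with $x\in E$, $y\in F$; put $K(E)=K(E,E)$. A closed densely defined $A$-linear operator $t:D(t)\subseteq E\to E$ with densely defined adjoint $t^*$ is called regular if $1+t^*t$ has dense range, and a regular operator is called selfadjoint if $t=t^*$. A regular operator $t$ is called Fredholm if there are $G,G'\in L(E)$ such that $Gt$ and $tG'$ are closable, their closures belong to $L(E)$, and $\overline{Gt}-1\in K(E)$, $\overline{tG'}-1\in K(E)$. For a regular operator $t$, let $E(t)$ be the Hilbert $A$-module $D(t)$ with the inner product $\langle x,y\rangle_t=\langle x,y\rangle+\langle tx,ty\rangle$; a regular operator $s$ is called $t$-compact if $D(t)\subseteq D(s)$ and $s|_{D(t)}:E(t)\to E$ belongs to $K(E(t),E)$. **Theorem.** Let $t$ and $s$ be selfadjoint regular operators on $E$. If $t$ is Fredholm and $s$ is $t$-compact, then $s+t$ (with domain $D(s)\cap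 D(t)=D(t)$) is a selfadjoint regular operator and is Fredholm. -/

import Mathlib

set_option linter.unusedSectionVars false

namespace HilbertCStar

/-! Throughout, `A` is a unital C*-algebra and `E`, `F` are (pre-)Hilbert `A`-modules, in the
convention of Mathlib's `CStarModule`: the `A`-valued inner product is `A`-linear in the second
variable and satisfies `inner A x (a • y) = a * inner A x y`. -/

section Bounded

variable {A E F : Type*} [CStarAlgebra A] [PartialOrder A] [StarOrderedRing A]
  [AddCommGroup E] [Module ℂ E] [Module A E] [Norm E] [CStarModule A E]
  [AddCommGroup F] [Module ℂ F] [Module A F] [Norm F] [CStarModule A F]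

/-- A linear map between Hilbert C*-modules is adjointable if it has an adjoint. -/
def IsAdjointable (T : E →ₗ[A] F) : Prop :=
  ∃ S : F →ₗ[A] E, ∀ (x : E) (y : F), inner A (T x) y = inner A x (S y)

/-- The elementary operator `z ↦ x ⟨y, z⟩` from `E` to `F`, for `x ∈ F` and `y ∈ E`. -/
def rankOne (x : F) (y : E) : E →ₗ[A] F where
  toFun z := (inner A y z : A) • x
  map_add' z w := by rw [CStarModule.inner_add_right, add_smul]
  map_smul' a z := by rw [CStarModule.inner_op_smul_right, mul_smul]; rfl

/-- Compact operators in the sense of Hilbert C*-modules: limits in operator norm of finite sums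
of elementary operators. -/
def IsCompactOp (T : E →ₗ[A] F) : Prop :=
  ∀ ε : ℝ, 0 < ε → ∃ (n : ℕ) (x : Fin n → F) (y : Fin n → E),
    ∀ z : E, ‖T z - (∑ i, rankOne (A := A) (x i) (y i)) z‖ ≤ ε * ‖z‖

end Bounded

section Unbounded

variable {A E : Type*} [CStarAlgebra A] [PartialOrder A] [StarOrderedRing A]
  [NormedAddCommGroup E] [NormedSpace ℂ E] [Module A E] [CStarModule A E]

variable (A E) in
/-- `E` is countably generated: some countable subset generates a dense `A`-submodule. -/
def CountablyGenerated : Prop :=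
  ∃ S : Set E, S.Countable ∧ Dense (Submodule.span A S : Set E)

/-- All pairs `(y, z)` with `⟨t x, y⟩ = ⟨x, z⟩` for all `x ∈ D(t)`. -/
def adjointGraph (t : E →ₗ.[A] E) : Submodule A (E × E) where
  carrier := {p | ∀ x : t.domain, inner A (t x) p.1 = inner A (x : E) p.2}
  add_mem' {p q} hp hq x := by
    simp only [Prod.fst_add, Prod.snd_add, CStarModule.inner_add_right, hp x, hq x]
  zero_mem' x := by simp
  smul_mem' a p hp x := by
    simp only [Prod.smul_fst, Prod.smul_snd, CStarModule.inner_op_smul_right, hp x]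

/-- The adjoint `t*`: its domain consists of the `y` for which there is a `z` with
`⟨t x, y⟩ = ⟨x, z⟩` for all `x ∈ D(t)`, and `t* y = z`. It is only meaningful for densely defined
`t`, where `z` is unique (see `graph_adjoint`). -/
noncomputable def adjoint (t : E →ₗ.[A] E) : E →ₗ.[A] E :=
  (adjointGraph t).toLinearPMap

theorem graph_adjoint (t : E →ₗ.[A] E) (ht : Dense (t.domain : Set E)) :
    (adjoint t).graph = adjointGraph t := by
  refine Submodule.toLinearPMap_graph_eq _ ?_
  rintro ⟨y, z⟩ h (rfl : y = 0)
  have h0 : ∀ x ∈ (t.domain : Set E), (inner A x z : A) = 0 := fun x hx => by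
    have := h ⟨x, hx⟩
    simpa using this.symm
  have hc : Continuous fun x : E => (inner A x z : A) :=
    CStarModule.continuous_inner.comp (by fun_prop : Continuous fun x : E => (x, z))
  have := congrFun (hc.ext_on ht continuous_const h0) z
  exact CStarModule.inner_self.1 this

/-- The composition `g f` of partially defined operators, with domain
`{x ∈ D(f) | f x ∈ D(g)}`. -/
def pcomp (g f : E →ₗ.[A] E) : E →ₗ.[A] E :=
  g.comp (f.domRestrict ((g.domain.comap f.toFun).map f.domain.subtype)) (by
    rintro ⟨x, ⟨y, hy, rfl⟩, hx⟩
    exact hy)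

theorem mem_pcomp_graph (g f : E →ₗ.[A] E) (x z : E) :
    (x, z) ∈ (pcomp g f).graph ↔ ∃ y, (x, y) ∈ f.graph ∧ (y, z) ∈ g.graph := by
  constructor
  · intro h
    obtain ⟨⟨x', ⟨y, hy, hyx⟩, hx⟩, rfl, rfl⟩ := (LinearPMap.mem_graph_iff _).1 h
    obtain rfl : y = ⟨x', hx⟩ := Subtype.ext hyx
    exact ⟨f ⟨x', hx⟩, LinearPMap.mem_graph f ⟨x', hx⟩, LinearPMap.mem_graph g ⟨_, hy⟩⟩
  · rintro ⟨y, h1, h2⟩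
    obtain ⟨x', rfl, rfl⟩ := (LinearPMap.mem_graph_iff _).1 h1
    obtain ⟨y', hy', rfl⟩ := (LinearPMap.mem_graph_iff _).1 h2
    have hx' : f x' ∈ g.domain := by
      have := y'.2
      rwa [hy'] at this
    refine (LinearPMap.mem_graph_iff _).2 ⟨⟨x', ⟨x', hx', rfl⟩, x'.2⟩, rfl, ?_⟩
    exact congrArg g (Subtype.ext hy'.symm)

/-- A closed densely defined operator with densely defined adjoint is regular if `1 + t* t` has
dense range. -/
structure IsRegular (t : E →ₗ.[A] E) : Prop where
  dense_domain : Dense (t.domain : Set E)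
  closed : IsClosed (t.graph : Set (E × E))
  dense_adjoint_domain : Dense ((adjoint t).domain : Set E)
  dense_range : DenseRange ((LinearMap.id : E →ₗ[A] E) +ᵥ pcomp (adjoint t) t)

/-- Selfadjoint regular operators: regular operators `t` with `t* = t`. -/
def IsSelfAdjointRegular (t : E →ₗ.[A] E) : Prop :=
  IsRegular t ∧ adjoint t = t

/-- The operator `u` is closable, its closure is a bounded adjointable operator, and this closure
is the identity modulo compact operators. -/
def ClosureIsOneModCompact (u : E →ₗ.[A] E) : Prop :=
  ∃ T : E →L[A] E, IsAdjointable (T : E →ₗ[A] E) ∧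
    closure (u.graph : Set (E × E)) = {p : E × E | p.2 = T p.1} ∧
    IsCompactOp ((T : E →ₗ[A] E) - LinearMap.id)

/-- The bounded adjointable operator `G` is a pseudo left inverse of `t`. -/
def IsPseudoLeftInverse (G : E →L[A] E) (t : E →ₗ.[A] E) : Prop :=
  IsAdjointable (G : E →ₗ[A] E) ∧
    ClosureIsOneModCompact (pcomp ((G : E →ₗ[A] E).toPMap ⊤) t)

/-- The bounded adjointable operator `G` is a pseudo right inverse of `t`. -/
def IsPseudoRightInverse (G : E →L[A] E) (t : E →ₗ.[A] E) : Prop :=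
  IsAdjointable (G : E →ₗ[A] E) ∧
    ClosureIsOneModCompact (pcomp t ((G : E →ₗ[A] E).toPMap ⊤))

/-- Fredholm operators: those with a pseudo left inverse and a pseudo right inverse. -/
def IsFredholm (t : E →ₗ.[A] E) : Prop :=
  (∃ G : E →L[A] E, IsPseudoLeftInverse G t) ∧ ∃ G : E →L[A] E, IsPseudoRightInverse G t

end Unbounded

section Graph

variable {A E : Type*} [CStarAlgebra A] [PartialOrder A] [StarOrderedRing A]
  [NormedAddCommGroup E] [NormedSpace ℂ E] [Module A E] [IsScalarTower ℂ A E] [CStarModule A E]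

/-- The module `E(t)`: the domain of `t`, to be equipped with the graph inner product. -/
def GraphModule (t : E →ₗ.[A] E) : Type _ := t.domain

namespace GraphModule

variable (t : E →ₗ.[A] E)

instance : AddCommGroup (GraphModule t) := inferInstanceAs (AddCommGroup t.domain)

instance : Module A (GraphModule t) := inferInstanceAs (Module A t.domain)

instance : Module ℂ (GraphModule t) := inferInstanceAs (Module ℂ t.domain)

instance : IsScalarTower ℂ A (GraphModule t) := inferInstanceAs (IsScalarTower ℂ A t.domain)

/-- The inclusion `E(t) → E`. -/
def incl : GraphModule t →ₗ[A] E := t.domain.subtype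

/-- The operator `t` as a map `E(t) → E`. -/
def op : GraphModule t →ₗ[A] E := t.toFun

theorem incl_injective : Function.Injective (incl t) := Subtype.val_injective

/-- The graph inner product `⟨x, y⟩ₜ = ⟨x, y⟩ + ⟨t x, t y⟩`. -/
noncomputable instance : Inner A (GraphModule t) where
  inner x y := inner A (incl t x) (incl t y) + inner A (op t x) (op t y)

theorem inner_def (x y : GraphModule t) :
    (inner A x y : A) = inner A (incl t x) (incl t y) + inner A (op t x) (op t y) := rfl

/-- The graph norm, induced by the graph inner product. -/
noncomputable instance : Norm (GraphModule t) := CStarModule.norm A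

noncomputable instance : CStarModule A (GraphModule t) where
  inner_add_right {x y z} := by
    simp only [inner_def, map_add, CStarModule.inner_add_right]
    abel
  inner_self_nonneg := add_nonneg CStarModule.inner_self_nonneg CStarModule.inner_self_nonneg
  inner_self {x} := by
    constructor
    · intro h
      have h1 := (add_eq_zero_iff_of_nonneg (CStarModule.inner_self_nonneg (A := A)
        (x := incl t x)) (CStarModule.inner_self_nonneg (A := A) (x := op t x))).1 h
      exact incl_injective t ((CStarModule.inner_self.1 h1.1).trans (map_zero _).symm)
    · rintro rfl
      simp [inner_def]
  inner_op_smul_right {a x y} := by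
    simp only [inner_def, map_smul, CStarModule.inner_op_smul_right, mul_add]
  inner_smul_right_complex {z x y} := by
    simp only [inner_def, LinearMap.map_smul_of_tower, CStarModule.inner_smul_right_complex,
      smul_add]
  star_inner x y := by
    simp only [inner_def, star_add, CStarModule.star_inner]
  norm_eq_sqrt_norm_inner_self _ := rfl

end GraphModule

/-- The restriction of `s` to `D(t) ⊆ D(s)`, as a map `E(t) → E`. -/
def restrictGraph (t s : E →ₗ.[A] E) (h : t.domain ≤ s.domain) : GraphModule t →ₗ[A] E :=
  s.toFun.comp ((GraphModule.incl t).codRestrict s.domain fun x => h (Subtype.property x))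

/-- `s` is `t`-compact: `D(t) ⊆ D(s)` and `s : E(t) → E` is compact. -/
def IsRelativelyCompact (t s : E →ₗ.[A] E) : Prop :=
  ∃ h : t.domain ≤ s.domain, IsCompactOp (restrictGraph t s h)

end Graph

end HilbertCStar

/-! For a symmetric `t` and real `r`, the cross terms cancel in `⟨(t + ri)x, (t + ri)x⟩ = ⟨tx, tx⟩ +
r²⟨x, x⟩`. So `t + ri` bounds both `‖tx‖` and `|r|‖x‖`, and a densely defined symmetric operator is
selfadjoint and regular once `t ± i` are onto (`IsSymmetricPMap.isSelfAdjointRegular`).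

Selfadjointness of `s + t` is a Kato–Rellich argument: `t`-compactness gives `s` relative bound zero
(`IsRelativelyCompact.exists_relative_bound`), so for large `|q|` the map `s + t + qi` is a small
perturbation of the surjective `t + qi`; a Neumann series makes it onto, and surjectivity moves back
to `±i`.

For Fredholmness, a right parametrix `G` of `t` maps into `D(t)` and `tG = T` is `1` modulo
compacts. Then `(s + t)G = T + sG`, and `sG` is compact because `G : E → E(t)` is adjointable.
Taking adjoints turns this right parametrix into a left one, by symmetry of `s + t`. -/

namespace HilbertCStar

open Filter Topology

/-! ### Adjointable and compact operators -/

section Bounded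

variable {A E F : Type*} [CStarAlgebra A] [PartialOrder A] [StarOrderedRing A]
  [NormedAddCommGroup E] [NormedSpace ℂ E] [Module A E] [CStarModule A E]
  [NormedAddCommGroup F] [NormedSpace ℂ F] [Module A F] [CStarModule A F]

variable (A) in
theorem ext_inner_left {x y : E} (h : ∀ z : E, (inner A z x : A) = inner A z y) : x = y := by
  rw [← sub_eq_zero, ← CStarModule.inner_self (A := A), CStarModule.inner_sub_right, h, sub_self]

theorem norm_op_smul_le (a : A) (x : E) : ‖a • x‖ ≤ ‖a‖ * ‖x‖ := by
  refine le_of_sq_le_sq ?_ (by positivity)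
  rw [CStarModule.norm_sq_eq A, CStarModule.inner_op_smul_left, CStarModule.inner_op_smul_right,
    mul_pow, CStarModule.norm_sq_eq A (x := x)]
  calc ‖a * inner A x x * star a‖ ≤ ‖a‖ * ‖(inner A x x : A)‖ * ‖star a‖ :=
        (norm_mul_le _ _).trans (by gcongr; exact norm_mul_le _ _)
    _ = ‖a‖ ^ 2 * ‖(inner A x x : A)‖ := by rw [norm_star]; ring

theorem sum_rankOne_apply {n : ℕ} (x : Fin n → F) (y : Fin n → E) (z : E) :
    (∑ i, rankOne (A := A) (x i) (y i)) z = ∑ i, (inner A (y i) z : A) • x i := by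
  simp [LinearMap.sum_apply, rankOne]

theorem inner_sum_rankOne {n : ℕ} (x : Fin n → F) (y : Fin n → E) (z : E) (w : F) :
    (inner A ((∑ i, rankOne (A := A) (x i) (y i)) z) w : A) =
      inner A z ((∑ i, rankOne (A := A) (y i) (x i)) w) := by
  simp [sum_rankOne_apply]

/-- From `‖S y‖² = ‖⟨T (S y), y⟩‖ ≤ c ‖S y‖ ‖y‖`. Additivity is not needed, so the lemma also
applies to differences given as plain functions. -/
theorem norm_le_of_adjoint {T : E → F} {S : F → E}
    (h : ∀ x y, (inner A (T x) y : A) = inner A x (S y)) {c : ℝ} (hc0 : 0 ≤ c)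
    (hc : ∀ x, ‖T x‖ ≤ c * ‖x‖) (y : F) : ‖S y‖ ≤ c * ‖y‖ := by
  rcases eq_or_ne (S y) 0 with h0 | h0
  · rw [h0, norm_zero]
    positivity
  · have hpos := norm_pos_iff.2 h0
    have : ‖S y‖ ^ 2 ≤ (c * ‖S y‖) * ‖y‖ := by
      rw [CStarModule.norm_sq_eq A, ← h]
      exact (CStarModule.norm_inner_le F).trans (by gcongr; exact hc _)
    nlinarith

/-- A linear map with a pointwise defined adjoint is adjointable. -/
theorem isAdjointable_of_exists {T : E →ₗ[A] F}
    (h : ∀ y, ∃ z, ∀ x, (inner A (T x) y : A) = inner A x z) : IsAdjointable T := by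
  choose S hS using h
  refine ⟨{ toFun := S, map_add' := fun y z => ?_, map_smul' := fun a y => ?_ }, fun x y => hS y x⟩
  · exact ext_inner_left A fun x => by simp [← hS]
  · exact ext_inner_left A fun x => by simp [← hS]

theorem IsAdjointable.add {T U : E →ₗ[A] F} (hT : IsAdjointable T) (hU : IsAdjointable U) :
    IsAdjointable (T + U) := by
  obtain ⟨S, hS⟩ := hT
  obtain ⟨V, hV⟩ := hU
  exact ⟨S + V, fun x y => by simp [hS, hV]⟩

theorem IsCompactOp.add {T U : E →ₗ[A] F} (hT : IsCompactOp T) (hU : IsCompactOp U) :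
    IsCompactOp (T + U) := by
  intro ε hε
  obtain ⟨n, x, y, h⟩ := hT (ε / 2) (by positivity)
  obtain ⟨m, x', y', h'⟩ := hU (ε / 2) (by positivity)
  refine ⟨n + m, Fin.append x x', Fin.append y y', fun z => ?_⟩
  rw [Fin.sum_univ_add]
  simp only [Fin.append_left, Fin.append_right, LinearMap.add_apply]
  calc _ = ‖(T z - (∑ i, rankOne (A := A) (x i) (y i)) z) +
        (U z - (∑ i, rankOne (A := A) (x' i) (y' i)) z)‖ := by congr 1; abel
    _ ≤ ε / 2 * ‖z‖ + ε / 2 * ‖z‖ := (norm_add_le _ _).trans (add_le_add (h z) (h' z))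
    _ = ε * ‖z‖ := by ring

theorem IsCompactOp.adjoint {T : E →ₗ[A] F} {S : F →ₗ[A] E} (hT : IsCompactOp T)
    (h : ∀ x y, (inner A (T x) y : A) = inner A x (S y)) : IsCompactOp S := by
  intro ε hε
  obtain ⟨n, x, y, hn⟩ := hT ε hε
  refine ⟨n, y, x, norm_le_of_adjoint (A := A) (fun z w => ?_) hε.le hn⟩
  rw [CStarModule.inner_sub_left, CStarModule.inner_sub_right, h, inner_sum_rankOne]

theorem IsCompactOp.exists_bound {T : E →ₗ[A] F} (hT : IsCompactOp T) :
    ∃ C, ∀ z, ‖T z‖ ≤ C * ‖z‖ := by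
  obtain ⟨n, x, y, h⟩ := hT 1 one_pos
  refine ⟨1 + ∑ i, ‖y i‖ * ‖x i‖, fun z => ?_⟩
  calc ‖T z‖ = ‖(T z - (∑ i, rankOne (A := A) (x i) (y i)) z) +
        ∑ i, (inner A (y i) z : A) • x i‖ := by rw [← sum_rankOne_apply]; simp
    _ ≤ 1 * ‖z‖ + ∑ i, ‖y i‖ * ‖z‖ * ‖x i‖ := by
        refine (norm_add_le _ _).trans (add_le_add (h z) ((norm_sum_le _ _).trans ?_))
        gcongr with i
        refine (norm_op_smul_le _ _).trans ?_
        gcongr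
        exact CStarModule.norm_inner_le E
    _ = (1 + ∑ i, ‖y i‖ * ‖x i‖) * ‖z‖ := by
        rw [add_mul, Finset.sum_mul]
        congr 1
        exact Finset.sum_congr rfl fun i _ => by ring

/-- Finite-rank approximants have explicit adjoints, and adjoints obey the same norm bounds. They
therefore form a Cauchy sequence at each vector, whose limit is the adjoint's value. -/
theorem IsCompactOp.isAdjointable [CompleteSpace E] {T : E →ₗ[A] F} (hT : IsCompactOp T) :
    IsAdjointable T := by
  refine isAdjointable_of_exists fun w => ?_
  have hpos : ∀ k : ℕ, (0 : ℝ) < (1 / 2) ^ k := fun k => by positivity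
  choose n x y h using fun k : ℕ => hT ((1 / 2) ^ k) (hpos k)
  set R : ℕ → E →ₗ[A] F := fun k => ∑ i, rankOne (A := A) (x k i) (y k i)
  set S : ℕ → F →ₗ[A] E := fun k => ∑ i, rankOne (A := A) (y k i) (x k i)
  have hRS : ∀ k z v, (inner A (R k z) v : A) = inner A z (S k v) := fun k z v =>
    inner_sum_rankOne _ _ _ _
  have hR : ∀ k z, ‖R k z - R (k + 1) z‖ ≤ 2 * (1 / 2) ^ k * ‖z‖ := fun k z => by
    calc ‖R k z - R (k + 1) z‖ = ‖(T z - R (k + 1) z) - (T z - R k z)‖ := by congr 1; abel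
      _ ≤ (1 / 2) ^ (k + 1) * ‖z‖ + (1 / 2) ^ k * ‖z‖ :=
        (norm_sub_le _ _).trans (add_le_add (h _ z) (h _ z))
      _ ≤ 2 * (1 / 2) ^ k * ‖z‖ := by
        rw [pow_succ]
        have := mul_nonneg (hpos k).le (norm_nonneg z)
        nlinarith
  have hS : ∀ k v, ‖S k v - S (k + 1) v‖ ≤ 2 * (1 / 2) ^ k * ‖v‖ := fun k =>
    norm_le_of_adjoint (A := A) (T := fun z => R k z - R (k + 1) z)
      (fun z v => by simp only [CStarModule.inner_sub_left, CStarModule.inner_sub_right, hRS])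
      (by positivity) (hR k)
  have hc : CauchySeq fun k => S k w := by
    refine cauchySeq_of_le_geometric (1 / 2) (2 * ‖w‖) (by norm_num) fun k => ?_
    rw [dist_eq_norm]
    exact (hS k w).trans (le_of_eq (by ring))
  obtain ⟨v, hv⟩ := cauchySeq_tendsto_of_complete hc
  refine ⟨v, fun z => ?_⟩
  have h1 : Tendsto (fun k => (inner A z (S k w) : A)) atTop (𝓝 (inner A z v)) :=
    (CStarModule.continuous_inner.tendsto (z, v)).comp (tendsto_const_nhds.prodMk_nhds hv)
  have h2 : Tendsto (fun k => R k z) atTop (𝓝 (T z)) := by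
    rw [tendsto_iff_norm_sub_tendsto_zero]
    refine squeeze_zero (fun _ => norm_nonneg _) (fun k => (norm_sub_rev _ _).trans_le (h k z)) ?_
    simpa using (tendsto_pow_atTop_nhds_zero_of_lt_one (r := (1 / 2 : ℝ)) (by norm_num)
      (by norm_num)).mul_const ‖z‖
  have h3 : Tendsto (fun k => (inner A (R k z) w : A)) atTop (𝓝 (inner A (T z) w)) :=
    (CStarModule.continuous_inner.tendsto (T z, w)).comp (h2.prodMk_nhds tendsto_const_nhds)
  simp only [hRS] at h3
  exact tendsto_nhds_unique h3 h1

end Bounded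

/-- Small relatively bounded perturbations of surjective linear maps are surjective. -/
theorem surjective_add_of_norm_le {D E : Type*} [AddCommGroup D] [Module ℂ D]
    [NormedAddCommGroup E] [NormedSpace ℂ E] [CompleteSpace E] {P Q : D →ₗ[ℂ] E}
    (hP : Function.Surjective P) {c : ℝ} (hc : c < 1) (hQ : ∀ w, ‖Q w‖ ≤ c * ‖P w‖) :
    Function.Surjective (P + Q) := by
  obtain ⟨R, hR⟩ := P.exists_rightInverse_of_surjective (LinearMap.range_eq_top.2 hP)
  have hPR : ∀ v, P (R v) = v := fun v => congrArg (fun f => f v) hR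
  -- With `R` a linear section of `P`, `(P + Q) R = 1 - K` and `‖K‖ < 1`. The maximum with `0` is
  -- there because `c` may be negative.
  set K : E →L[ℂ] E := (-(Q ∘ₗ R)).mkContinuous (max c 0) fun v => by
    simp only [LinearMap.neg_apply, LinearMap.comp_apply, norm_neg]
    calc ‖Q (R v)‖ ≤ c * ‖v‖ := by simpa [hPR] using hQ (R v)
      _ ≤ max c 0 * ‖v‖ := by gcongr; exact le_max_left _ _ with hK
  have hu : IsUnit (1 - K) := isUnit_one_sub_of_norm_lt_one
    ((LinearMap.mkContinuous_norm_le _ (le_max_right _ _) _).trans_lt (max_lt hc one_pos))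
  obtain ⟨u, hu⟩ := hu
  intro y
  refine ⟨R ((u⁻¹ : (E →L[ℂ] E)ˣ).1 y), ?_⟩
  have h1 : (1 - K) ((u⁻¹ : (E →L[ℂ] E)ˣ).1 y) = y := by
    rw [← hu]
    exact congrArg (fun f : E →L[ℂ] E => f y) u.mul_inv
  simpa [hK, hPR] using h1

/-! ### Symmetric operators and surjectivity of `t + ri` -/

section Unbounded

variable {A E : Type*} [CStarAlgebra A] [PartialOrder A] [StarOrderedRing A]
  [NormedAddCommGroup E] [NormedSpace ℂ E] [Module A E] [IsScalarTower ℂ A E] [CStarModule A E]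

/-- Symmetric partially defined operators. -/
def IsSymmetricPMap (t : E →ₗ.[A] E) : Prop :=
  ∀ x y : t.domain, (inner A (t x) (y : E) : A) = inner A (x : E) (t y)

/-- The operator `t + r i`, for a real number `r`. -/
noncomputable def shift (t : E →ₗ.[A] E) (r : ℝ) : t.domain →ₗ[ℂ] E :=
  t.toFun.restrictScalars ℂ + ((r : ℂ) * Complex.I) • t.domain.subtype.restrictScalars ℂ

theorem shift_apply (t : E →ₗ.[A] E) (r : ℝ) (x : t.domain) :
    shift t r x = t x + ((r : ℂ) * Complex.I) • (x : E) := rfl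

theorem IsSymmetricPMap.inner_shift {t : E →ₗ.[A] E} (ht : IsSymmetricPMap t) (r : ℝ)
    (x : t.domain) : (inner A (shift t r x) (shift t r x) : A) =
      inner A (t x) (t x) + (r ^ 2 : ℝ) • inner A (x : E) (x : E) := by
  have h : ((r : ℂ) * Complex.I) * star ((r : ℂ) * Complex.I) = ((r ^ 2 : ℝ) : ℂ) := by
    simp only [star_mul', Complex.star_def, Complex.conj_I, Complex.conj_ofReal]
    push_cast
    linear_combination (-(r : ℂ) ^ 2) * Complex.I_sq
  have h' : star ((r : ℂ) * Complex.I) = -((r : ℂ) * Complex.I) := by simp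
  rw [shift_apply]
  simp only [CStarModule.inner_add_left, CStarModule.inner_add_right,
    CStarModule.inner_smul_left_complex, CStarModule.inner_smul_right_complex, smul_smul,
    smul_add, h, ht x x]
  rw [h', Complex.coe_smul]
  module

theorem IsSymmetricPMap.norm_apply_le {t : E →ₗ.[A] E} (ht : IsSymmetricPMap t) (r : ℝ)
    (x : t.domain) : ‖t x‖ ≤ ‖shift t r x‖ := by
  refine le_of_sq_le_sq ?_ (norm_nonneg _)
  rw [CStarModule.norm_sq_eq A, CStarModule.norm_sq_eq A, ht.inner_shift]
  refine CStarAlgebra.norm_le_norm_of_nonneg_of_le CStarModule.inner_self_nonneg ?_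
  exact le_add_of_nonneg_right (smul_nonneg (sq_nonneg r) CStarModule.inner_self_nonneg)

theorem IsSymmetricPMap.norm_coe_le {t : E →ₗ.[A] E} (ht : IsSymmetricPMap t) (r : ℝ)
    (x : t.domain) : |r| * ‖(x : E)‖ ≤ ‖shift t r x‖ := by
  refine le_of_sq_le_sq ?_ (norm_nonneg _)
  rw [mul_pow, sq_abs, CStarModule.norm_sq_eq A, CStarModule.norm_sq_eq A, ht.inner_shift,
    ← Real.norm_of_nonneg (sq_nonneg r), ← norm_smul, Real.norm_of_nonneg (sq_nonneg r)]
  refine CStarAlgebra.norm_le_norm_of_nonneg_of_le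
    (smul_nonneg (sq_nonneg r) CStarModule.inner_self_nonneg) ?_
  exact le_add_of_nonneg_left (CStarModule.inner_self_nonneg (A := A) (x := t x))

/-- The difference `(r' - r)i` has bound `|r' - r| / |r| < 1` relative to `t + ri`, since `|r|‖x‖ ≤
‖(t + ri)x‖`. -/
theorem IsSymmetricPMap.surjective_shift_of_near [CompleteSpace E] {t : E →ₗ.[A] E}
    (ht : IsSymmetricPMap t) {r r' : ℝ} (h : |r' - r| < |r|)
    (hr : Function.Surjective (shift t r)) : Function.Surjective (shift t r') := by
  have h0 : 0 < |r| := (abs_nonneg _).trans_lt h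
  have := surjective_add_of_norm_le (c := |r' - r| / |r|)
    (Q := (((r' - r : ℝ) : ℂ) * Complex.I) • t.domain.subtype.restrictScalars ℂ) hr
    ((div_lt_one h0).2 h) fun w => by
      calc _ = |r' - r| * ‖(w : E)‖ := by simp [norm_smul, -Complex.ofReal_sub]
        _ = |r' - r| / |r| * (|r| * ‖(w : E)‖) := by field_simp
        _ ≤ _ := by gcongr; exact ht.norm_coe_le r w
  convert this using 2
  ext x
  simp only [shift_apply, LinearMap.add_apply, LinearMap.smul_apply]
  rw [add_assoc]
  congr 1
  change _ = _ + _ • (x : E)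
  rw [← add_smul]
  congr 1
  push_cast
  ring

theorem IsSymmetricPMap.surjective_shift_pow [CompleteSpace E] {t : E →ₗ.[A] E}
    (ht : IsSymmetricPMap t) {r : ℝ} (h0 : r ≠ 0) (hr : Function.Surjective (shift t r)) (n : ℕ) :
    Function.Surjective (shift t ((3 / 2) ^ n * r)) := by
  induction n with
  | zero => simpa using hr
  | succ n ih =>
    -- Any growth factor strictly between 1 and 2 keeps the step shorter than the current modulus.
    refine ht.surjective_shift_of_near ?_ ih
    have : (3 / 2 : ℝ) ^ (n + 1) * r - (3 / 2) ^ n * r = 1 / 2 * ((3 / 2) ^ n * r) := by ring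
    rw [this, abs_mul]
    have h1 : (0 : ℝ) < |(3 / 2) ^ n * r| := abs_pos.2 (by positivity)
    rw [abs_of_pos (by norm_num : (0 : ℝ) < 1 / 2)]
    linarith

theorem IsSelfAdjointRegular.isSymmetricPMap {t : E →ₗ.[A] E} (ht : IsSelfAdjointRegular t) :
    IsSymmetricPMap t := fun x y => by
  have h : ((y : E), t y) ∈ (adjoint t).graph := by
    have := LinearPMap.mem_graph t y
    rwa [← congrArg LinearPMap.graph ht.2] at this
  rw [graph_adjoint t ht.1.dense_domain] at h
  exact h x

/-- The range is the image of the complete graph of `t` under a uniformly continuous map that is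
bounded below: for `|r| = 1` the max norm of `(x, tx)` is at most `‖(t + ri)x‖`. -/
theorem IsSymmetricPMap.isClosed_range_shift [CompleteSpace E] {t : E →ₗ.[A] E}
    (ht : IsSymmetricPMap t) (hc : IsClosed (t.graph : Set (E × E))) {r : ℝ} (hr : |r| = 1) :
    IsClosed (Set.range (shift t r)) := by
  have : CompleteSpace (t.graph : Set (E × E)) := hc.completeSpace_coe
  let φ : ((t.graph : Set (E × E)) : Type _) → E := fun p => p.1.2 + ((r : ℂ) * Complex.I) • p.1.1
  have hφ : Set.range φ = Set.range (shift t r) := by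
    ext y
    constructor
    · rintro ⟨⟨⟨x, z⟩, h⟩, rfl⟩
      obtain ⟨x', rfl, rfl⟩ := (LinearPMap.mem_graph_iff _).1 h
      exact ⟨x', rfl⟩
    · rintro ⟨x, rfl⟩
      exact ⟨⟨_, LinearPMap.mem_graph t x⟩, rfl⟩
  have ha : AntilipschitzWith 1 φ := by
    refine AntilipschitzWith.of_le_mul_dist ?_
    rintro ⟨⟨x, z⟩, h⟩ ⟨⟨x', z'⟩, h'⟩
    obtain ⟨w, rfl, rfl⟩ := (LinearPMap.mem_graph_iff _).1 h
    obtain ⟨w', rfl, rfl⟩ := (LinearPMap.mem_graph_iff _).1 h'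
    have key : dist (shift t r w) (shift t r w') = ‖shift t r (w - w')‖ := by
      rw [dist_eq_norm, map_sub]
    change dist ((w : E), t w) ((w' : E), t w') ≤ (1 : NNReal) * dist (shift t r w) (shift t r w')
    rw [key, NNReal.coe_one, one_mul, Prod.dist_eq, dist_eq_norm, dist_eq_norm,
      ← LinearPMap.map_sub]
    exact max_le (by simpa [hr] using ht.norm_coe_le r (w - w')) (ht.norm_apply_le r (w - w'))
  have hu : UniformContinuous φ :=
    (uniformContinuous_snd.comp uniformContinuous_subtype_val).add
      ((uniformContinuous_fst.comp uniformContinuous_subtype_val).const_smul _)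
  rw [← hφ]
  exact ha.isClosed_range hu

/-- The range is closed, and it is dense because it contains the range of `1 + t*t`. -/
theorem IsSelfAdjointRegular.surjective_shift [CompleteSpace E] {t : E →ₗ.[A] E}
    (ht : IsSelfAdjointRegular t) {r : ℝ} (hr : |r| = 1) : Function.Surjective (shift t r) := by
  have hsub : Set.range ((LinearMap.id : E →ₗ[A] E) +ᵥ pcomp (adjoint t) t) ⊆
      Set.range (shift t r) := by
    rintro _ ⟨x, rfl⟩
    obtain ⟨y, hy, hyz⟩ := (mem_pcomp_graph _ _ _ _).1 (LinearPMap.mem_graph (pcomp _ t) x)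
    rw [LinearPMap.vadd_apply]
    generalize pcomp (adjoint t) t x = z at hyz
    rw [ht.2] at hyz
    obtain ⟨x', hx', rfl⟩ := (LinearPMap.mem_graph_iff _).1 hy
    obtain ⟨y', hy', rfl⟩ := (LinearPMap.mem_graph_iff _).1 hyz
    -- The factorisation `1 + t² = (t + ri)(t - ri)` for `r² = 1`.
    refine ⟨y' - ((r : ℂ) * Complex.I) • x', ?_⟩
    have hI : ((r : ℂ) * Complex.I) * ((r : ℂ) * Complex.I) = -1 := by
      have : (r : ℂ) ^ 2 = 1 := by exact_mod_cast (sq_abs r).symm.trans (by simp [hr])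
      linear_combination (r : ℂ) ^ 2 * Complex.I_sq - this
    simp only at hx' hy'
    rw [map_sub, map_smul, shift_apply, shift_apply, smul_add, smul_smul, hI, hy', hx',
      LinearMap.id_apply]
    module
  have hd : DenseRange (shift t r) := ht.1.dense_range.mono hsub
  exact Set.range_eq_univ.1
    ((ht.isSymmetricPMap.isClosed_range_shift ht.1.closed hr).closure_eq ▸ hd.closure_range)

theorem isClosed_adjointGraph (t : E →ₗ.[A] E) : IsClosed (adjointGraph t : Set (E × E)) := by
  have : (adjointGraph t : Set (E × E)) = ⋂ x : t.domain,
      {p | (inner A (t x) p.1 : A) = inner A (x : E) p.2} := by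
    ext p
    simp only [Set.mem_iInter]
    rfl
  rw [this]
  refine isClosed_iInter fun x => isClosed_eq ?_ ?_
  · exact CStarModule.continuous_inner.comp
      (by fun_prop : Continuous fun p : E × E => (t x, p.1))
  · exact CStarModule.continuous_inner.comp
      (by fun_prop : Continuous fun p : E × E => ((x : E), p.2))

/-- A densely defined symmetric operator `t` with `t ± i` surjective is selfadjoint and regular. -/
theorem IsSymmetricPMap.isSelfAdjointRegular {t : E →ₗ.[A] E} (ht : IsSymmetricPMap t)
    (hd : Dense (t.domain : Set E)) (h1 : Function.Surjective (shift t 1))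
    (h2 : Function.Surjective (shift t (-1))) : IsSelfAdjointRegular t := by
  have hadj : adjoint t = t := by
    refine LinearPMap.eq_of_eq_graph ?_
    rw [graph_adjoint t hd]
    refine le_antisymm ?_ ?_
    · rintro ⟨y, z⟩ h
      -- For `(y, z)` in the adjoint graph, `⟨(t - i)x, y⟩ = ⟨x, z + iy⟩ = ⟨x, (t + i)w⟩ = ⟨(t -
      -- i)x, w⟩`; as `t - i` is onto, `y = w ∈ D(t)`.
      obtain ⟨w, hw⟩ := h1 (z + Complex.I • y)
      have hyw : y = w := by
        refine ext_inner_left A fun v => ?_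
        obtain ⟨x, rfl⟩ := h2 v
        have hx : (inner A (t x) y : A) = inner A (x : E) z := h x
        have e : (inner A (x : E) (shift t 1 w) : A) = inner A (x : E) (z + Complex.I • y) := by
          rw [hw]
        simp only [shift_apply, CStarModule.inner_add_right, CStarModule.inner_add_left,
          CStarModule.inner_smul_right_complex, CStarModule.inner_smul_left_complex,
          ← ht x w, hx] at e ⊢
        simp at e ⊢
        exact e.symm
      subst hyw
      refine (LinearPMap.mem_graph_iff _).2 ⟨w, rfl, ?_⟩
      simpa [shift_apply] using hw
    · intro p hp
      obtain ⟨y, rfl⟩ := (LinearPMap.mem_graph_iff' _).1 hp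
      exact fun x => ht x y
  refine ⟨⟨hd, ?_, ?_, ?_⟩, hadj⟩
  · rw [← congrArg LinearPMap.graph hadj, graph_adjoint t hd]
    exact isClosed_adjointGraph t
  · rwa [hadj]
  · refine Function.Surjective.denseRange fun y => ?_
    -- Solves `(1 + t²)w = (t + i)(t - i)w = y`, so `1 + t*t` is even onto.
    obtain ⟨v, hv⟩ := h1 y
    obtain ⟨w, hw⟩ := h2 v
    have hwv : t w = (v : E) + Complex.I • (w : E) := by
      simp only [shift_apply, Complex.ofReal_neg, Complex.ofReal_one, neg_mul, one_mul] at hw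
      rw [← hw]
      module
    have hmem : ((w : E), t v + Complex.I • t w) ∈ (pcomp (adjoint t) t).graph := by
      refine (mem_pcomp_graph _ _ _ _).2 ⟨t w, LinearPMap.mem_graph t w, ?_⟩
      rw [hadj]
      refine (LinearPMap.mem_graph_iff _).2 ⟨v + Complex.I • w, hwv.symm, ?_⟩
      exact (t.toFun.map_add _ _).trans
        (congrArg _ ((t.toFun.restrictScalars ℂ).map_smul Complex.I w))
    obtain ⟨x, hx, hx'⟩ := (LinearPMap.mem_graph_iff _).1 hmem
    refine ⟨x, ?_⟩
    rw [LinearPMap.vadd_apply, hx', LinearMap.id_apply, hx, ← hv, hwv, shift_apply, smul_add,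
      smul_smul, Complex.I_mul_I, Complex.ofReal_one, one_mul]
    module

end Unbounded

/-! ### Relatively compact perturbations: selfadjointness and regularity -/

section Graph

variable {A E : Type*} [CStarAlgebra A] [PartialOrder A] [StarOrderedRing A]
  [NormedAddCommGroup E] [NormedSpace ℂ E] [Module A E] [IsScalarTower ℂ A E] [CStarModule A E]

theorem GraphModule.norm_le {t : E →ₗ.[A] E} (x : GraphModule t) :
    ‖x‖ ≤ ‖incl t x‖ + ‖op t x‖ := by
  refine le_of_sq_le_sq ?_ (by positivity)
  rw [CStarModule.norm_sq_eq A, GraphModule.inner_def]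
  refine (norm_add_le _ _).trans ?_
  rw [← CStarModule.norm_sq_eq A, ← CStarModule.norm_sq_eq A]
  nlinarith [norm_nonneg (incl t x), norm_nonneg (op t x)]

/-- A relatively compact operator has an approximation by operators of finite rank. -/
theorem IsRelativelyCompact.exists_approx {t s : E →ₗ.[A] E} (h : IsRelativelyCompact t s)
    {ε : ℝ} (hε : 0 < ε) : ∃ (n : ℕ) (x : Fin n → E) (y : Fin n → t.domain), ∀ z : t.domain,
      ‖s ⟨z, h.1 z.2⟩ - ∑ i, (inner A (y i : E) (z : E) + inner A (t (y i)) (t z) : A) • x i‖ ≤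
        ε * (‖(z : E)‖ + ‖t z‖) := by
  obtain ⟨hd, hc⟩ := h
  obtain ⟨n, x, y, hn⟩ := hc ε hε
  refine ⟨n, x, y, fun (z : GraphModule t) => ?_⟩
  have h1 := (hn z).trans (mul_le_mul_of_nonneg_left (GraphModule.norm_le z) hε.le)
  rwa [LinearMap.sum_apply] at h1

/-- In a finite-rank approximant only `⟨t yᵢ, t z⟩` is not controlled by `‖z‖`. Replacing `t yᵢ` by
a nearby `vᵢ ∈ D(t)` costs a small multiple of `‖t z‖`, and symmetry gives `⟨vᵢ, t z⟩ = ⟨t vᵢ, z⟩`.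
-/
theorem IsRelativelyCompact.exists_relative_bound {t s : E →ₗ.[A] E} (h : IsRelativelyCompact t s)
    (ht : IsSymmetricPMap t) (hd : Dense (t.domain : Set E)) {ε : ℝ} (hε : 0 < ε) :
    ∃ C, 0 ≤ C ∧ ∀ z : t.domain, ‖s ⟨z, h.1 z.2⟩‖ ≤ ε * ‖t z‖ + C * ‖(z : E)‖ := by
  obtain ⟨n, x, y, hn⟩ := h.exists_approx (half_pos hε)
  set M := ∑ i, ‖x i‖ with hM
  have hM0 : 0 ≤ M := by positivity
  -- Half of `ε` pays for the finite-rank approximation, the other half for replacing the `t yᵢ`.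
  set δ := ε / 2 / (1 + M) with hδ
  have hδ0 : 0 < δ := by positivity
  have hδM : δ * M ≤ ε / 2 := by
    rw [hδ, div_mul_eq_mul_div, div_le_iff₀ (by positivity)]
    nlinarith
  have key : ∀ i, ∃ v : t.domain, ‖t (y i) - v‖ < δ := fun i => by
    obtain ⟨v, hv, hv'⟩ := Metric.dense_iff.1 hd (t (y i)) δ hδ0
    exact ⟨⟨v, hv'⟩, by rwa [Metric.mem_ball, dist_comm, dist_eq_norm] at hv⟩
  choose v hv using key
  refine ⟨ε / 2 + ∑ i, (‖(y i : E)‖ + ‖t (v i)‖) * ‖x i‖, by positivity, fun z => ?_⟩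
  have hi : ∀ i, ‖(inner A (y i : E) (z : E) + inner A (t (y i)) (t z) : A) • x i‖ ≤
      δ * ‖t z‖ * ‖x i‖ + (‖(y i : E)‖ + ‖t (v i)‖) * ‖x i‖ * ‖(z : E)‖ := fun i => by
    have e : (inner A (y i : E) (z : E) + inner A (t (y i)) (t z) : A) =
        inner A (t (y i) - v i) (t z) + (inner A (y i : E) (z : E) + inner A (t (v i)) (z : E)) := by
      rw [ht (v i) z, CStarModule.inner_sub_left]
      abel
    have e1 : ‖(inner A (t (y i) - v i) (t z) : A)‖ ≤ δ * ‖t z‖ :=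
      (CStarModule.norm_inner_le E).trans (by gcongr; exact (hv i).le)
    have e2 : ‖(inner A (y i : E) (z : E) : A)‖ ≤ ‖(y i : E)‖ * ‖(z : E)‖ :=
      CStarModule.norm_inner_le E
    have e3 : ‖(inner A (t (v i)) (z : E) : A)‖ ≤ ‖t (v i)‖ * ‖(z : E)‖ :=
      CStarModule.norm_inner_le E
    rw [e]
    calc _ ≤ (δ * ‖t z‖ + (‖(y i : E)‖ * ‖(z : E)‖ + ‖t (v i)‖ * ‖(z : E)‖)) * ‖x i‖ := by
          refine (norm_op_smul_le _ _).trans ?_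
          gcongr
          exact (norm_add_le _ _).trans (add_le_add e1 ((norm_add_le _ _).trans (add_le_add e2 e3)))
      _ = _ := by ring
  have hsum := (norm_sum_le Finset.univ
    fun i => (inner A (y i : E) (z : E) + inner A (t (y i)) (t z) : A) • x i).trans
    (Finset.sum_le_sum fun i _ => hi i)
  rw [Finset.sum_add_distrib, ← Finset.mul_sum, ← Finset.sum_mul, ← hM] at hsum
  have htri := norm_le_norm_add_norm_sub' (s ⟨z, h.1 z.2⟩)
    (∑ i, (inner A (y i : E) (z : E) + inner A (t (y i)) (t z) : A) • x i)
  have := mul_le_mul_of_nonneg_right hδM (norm_nonneg (t z))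
  nlinarith [hn z]

theorem IsSymmetricPMap.add {s t : E →ₗ.[A] E} (hs : IsSymmetricPMap s) (ht : IsSymmetricPMap t) :
    IsSymmetricPMap (s + t) := fun x y => by
  rw [LinearPMap.add_apply, LinearPMap.add_apply, CStarModule.inner_add_left,
    CStarModule.inner_add_right]
  exact congrArg₂ _ (hs ⟨x, x.2.1⟩ ⟨y, y.2.1⟩) (ht ⟨x, x.2.2⟩ ⟨y, y.2.2⟩)

theorem IsRelativelyCompact.surjective_shift_add [CompleteSpace E] {t s : E →ₗ.[A] E}
    (h : IsRelativelyCompact t s) (ht : IsSelfAdjointRegular t) (hs : IsSymmetricPMap s) {r : ℝ}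
    (hr : |r| = 1) : Function.Surjective (shift (s + t) r) := by
  have hts := ht.isSymmetricPMap
  have hr0 : r ≠ 0 := by
    rintro rfl
    simp at hr
  -- With `|q| ≥ 4C`, both `‖t w‖ / 4` and `C‖w‖` are at most a quarter of `‖(t + qi)w‖`, giving
  -- relative bound 1/2.
  obtain ⟨C, hC0, hC⟩ := h.exists_relative_bound hts ht.1.dense_domain
    (by norm_num : (0 : ℝ) < 1 / 4)
  obtain ⟨n, hn⟩ := pow_unbounded_of_one_lt (4 * C + 1) (by norm_num : (1 : ℝ) < 3 / 2)
  set q : ℝ := (3 / 2) ^ n * r with hq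
  have hqabs : |q| = (3 / 2) ^ n := by
    rw [hq, abs_mul, hr, mul_one, abs_of_pos (by positivity)]
  have hsurj : Function.Surjective (shift (s + t) q) := by
    have := surjective_add_of_norm_le (c := 1 / 2) (P := shift t q)
      (Q := (s.toFun ∘ₗ Submodule.inclusion h.1).restrictScalars ℂ)
      (hts.surjective_shift_pow hr0 (ht.surjective_shift hr) n) (by norm_num) fun w => by
        have h1 := hC w
        have h2 := hts.norm_apply_le q w
        have h3 := hts.norm_coe_le q w
        rw [hqabs] at h3
        have h4 : 4 * C * ‖(w : E)‖ ≤ (3 / 2) ^ n * ‖(w : E)‖ := by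
          gcongr
          linarith
        change ‖s ⟨w, h.1 w.2⟩‖ ≤ _
        linarith
    intro y
    obtain ⟨w, hw⟩ := this y
    refine ⟨⟨w, h.1 w.2, w.2⟩, ?_⟩
    rw [← hw, shift_apply, LinearPMap.add_apply, LinearMap.add_apply, shift_apply]
    change s ⟨w, _⟩ + t w + _ = t w + _ + s ⟨w, _⟩
    abel
  -- One step suffices to come back: `q` is a positive multiple of `r` and `|r - q| = |q| - 1 <
  -- |q|`.
  refine (hs.add hts).surjective_shift_of_near ?_ hsurj
  have h1 : (1 : ℝ) ≤ (3 / 2) ^ n := one_le_pow₀ (by norm_num)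
  have e : r - q = -(((3 / 2) ^ n - 1) * r) := by rw [hq]; ring
  rw [e, abs_neg, abs_mul, hr, hqabs, abs_of_nonneg (by linarith)]
  linarith

theorem IsRelativelyCompact.isSelfAdjointRegular_add [CompleteSpace E] {t s : E →ₗ.[A] E}
    (h : IsRelativelyCompact t s) (ht : IsSelfAdjointRegular t) (hs : IsSymmetricPMap s) :
    IsSelfAdjointRegular (s + t) := by
  refine (hs.add ht.isSymmetricPMap).isSelfAdjointRegular ?_
    (h.surjective_shift_add ht hs (by simp)) (h.surjective_shift_add ht hs (by simp))
  rw [LinearPMap.add_domain, inf_eq_right.2 h.1]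
  exact ht.1.dense_domain

end Graph

/-! ### Parametrices of symmetric operators -/

section Fredholm

variable {A E : Type*} [CStarAlgebra A] [PartialOrder A] [StarOrderedRing A]
  [NormedAddCommGroup E] [NormedSpace ℂ E] [Module A E] [CStarModule A E]

theorem inner_adjoint_left {T S : E →ₗ[A] E}
    (h : ∀ x y, (inner A (T x) y : A) = inner A x (S y)) (x y : E) :
    (inner A (S x) y : A) = inner A x (T y) := by
  rw [← CStarModule.star_inner, ← h, CStarModule.star_inner]

/-- The adjoint of a bounded operator, as a bounded operator. -/
theorem IsAdjointable.exists_adjoint {T : E →L[A] E} (h : IsAdjointable (T : E →ₗ[A] E)) {C : ℝ}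
    (hC : ∀ x, ‖T x‖ ≤ C * ‖x‖) :
    ∃ S : E →L[A] E, ∀ x y, (inner A (T x) y : A) = inner A x (S y) := by
  obtain ⟨S, hS⟩ := h
  have hb := norm_le_of_adjoint (A := A) hS (le_max_right C 0) fun x =>
    (hC x).trans (by gcongr; exact le_max_left _ _)
  exact ⟨⟨S, AddMonoidHomClass.continuous_of_bound S _ hb⟩, hS⟩

theorem mem_graph_toPMap_top (T : E →ₗ[A] E) (x y : E) :
    (x, y) ∈ (T.toPMap ⊤).graph ↔ y = T x := by
  rw [LinearPMap.mem_graph_iff]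
  constructor
  · rintro ⟨z, rfl, rfl⟩
    rfl
  · rintro rfl
    exact ⟨⟨x, trivial⟩, rfl, rfl⟩

theorem mem_graph_pcomp_toPMap_top (t : E →ₗ.[A] E) (G : E →ₗ[A] E) (x y : E) :
    (x, y) ∈ (pcomp t (G.toPMap ⊤)).graph ↔ (G x, y) ∈ t.graph := by
  simp only [mem_pcomp_graph, mem_graph_toPMap_top, exists_eq_left]

theorem isClosed_graph_clm (T : E →L[A] E) : IsClosed {p : E × E | p.2 = T p.1} :=
  isClosed_eq continuous_snd (T.continuous.comp continuous_fst)

/-- The graph of `tG` is the preimage of the closed graph of `t` under a continuous map, so `tG` is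
already closed and equals `T` everywhere. -/
theorem mem_graph_of_closure_eq {t : E →ₗ.[A] E} (ht : IsClosed (t.graph : Set (E × E)))
    {G T : E →L[A] E}
    (h : closure ((pcomp t ((G : E →ₗ[A] E).toPMap ⊤)).graph : Set (E × E)) =
      {p : E × E | p.2 = T p.1}) (x : E) : (G x, T x) ∈ t.graph := by
  have hc : IsClosed ((pcomp t ((G : E →ₗ[A] E).toPMap ⊤)).graph : Set (E × E)) := by
    have e : ((pcomp t ((G : E →ₗ[A] E).toPMap ⊤)).graph : Set (E × E)) =
        (fun p : E × E => (G p.1, p.2)) ⁻¹' t.graph := by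
      ext ⟨x, y⟩
      exact mem_graph_pcomp_toPMap_top t (G : E →ₗ[A] E) x y
    rw [e]
    exact ht.preimage ((G.continuous.comp continuous_fst).prodMk continuous_snd)
  rw [hc.closure_eq] at h
  have hx : (x, T x) ∈ {p : E × E | p.2 = T p.1} := rfl
  rw [← h] at hx
  exact (mem_graph_pcomp_toPMap_top t (G : E →ₗ[A] E) x (T x)).1 hx

/-- For a symmetric operator, a right inverse modulo compact operators suffices for the Fredholm
property, since its adjoint is a left inverse modulo compact operators. -/
theorem IsSymmetricPMap.isFredholm {t : E →ₗ.[A] E} (ht : IsSymmetricPMap t)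
    (hd : Dense (t.domain : Set E)) {G T : E →L[A] E} (hG : IsAdjointable (G : E →ₗ[A] E))
    (hT : IsAdjointable (T : E →ₗ[A] E)) {C C' : ℝ} (hGC : ∀ x, ‖G x‖ ≤ C * ‖x‖)
    (hTC : ∀ x, ‖T x‖ ≤ C' * ‖x‖) (hGT : ∀ x, (G x, T x) ∈ t.graph)
    (hK : IsCompactOp ((T : E →ₗ[A] E) - LinearMap.id)) : IsFredholm t := by
  obtain ⟨H, hH⟩ := hG.exists_adjoint hGC
  obtain ⟨S, hS⟩ := hT.exists_adjoint hTC
  -- With `H = G*` and `S = T*`: `⟨w, H t x⟩ = ⟨G w, t x⟩ = ⟨t G w, x⟩ = ⟨T w, x⟩ = ⟨w, S x⟩`.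
  have hHS : ∀ x : t.domain, H (t x) = S x := fun x => ext_inner_left A fun w => by
    obtain ⟨v, hv, hv'⟩ := (LinearPMap.mem_graph_iff _).1 (hGT w)
    simp only at hv hv'
    rw [← hH, ← hS, ← hv, ← hv', ht]
  refine ⟨⟨H, ⟨(G : E →ₗ[A] E), inner_adjoint_left hH⟩, S,
    ⟨(T : E →ₗ[A] E), inner_adjoint_left hS⟩, ?_, ?_⟩, ⟨G, hG, T, hT, ?_, hK⟩⟩
  · have hgr : ∀ x z, (x, z) ∈ (pcomp ((H : E →ₗ[A] E).toPMap ⊤) t).graph ↔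
        ∃ y, (x, y) ∈ t.graph ∧ z = H y := fun x z => by
      simp only [mem_pcomp_graph, mem_graph_toPMap_top]
      rfl
    refine subset_antisymm (closure_minimal ?_ (isClosed_graph_clm S)) ?_
    · rintro ⟨x, z⟩ hxz
      obtain ⟨y, hy, rfl⟩ := (hgr x z).1 hxz
      obtain ⟨x, rfl, rfl⟩ := (LinearPMap.mem_graph_iff _).1 hy
      exact hHS x
    · rintro ⟨x, z⟩ (rfl : z = S x)
      -- The graph of `S` over the dense set `D(t)` lies in the graph of `Ht`; continuity of `S`
      -- does the rest.
      refine map_mem_closure (f := fun x => (x, S x)) (by fun_prop) (hd x) fun y hy => ?_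
      exact (hgr y (S y)).2 ⟨t ⟨y, hy⟩, LinearPMap.mem_graph t ⟨y, hy⟩, (hHS ⟨y, hy⟩).symm⟩
  · refine hK.adjoint fun x y => ?_
    simp only [LinearMap.sub_apply, CStarModule.inner_sub_left, CStarModule.inner_sub_right]
    exact congrArg₂ _ (hS x y) rfl
  · have e : ((pcomp t ((G : E →ₗ[A] E).toPMap ⊤)).graph : Set (E × E)) =
        {p : E × E | p.2 = T p.1} := by
      ext ⟨x, y⟩
      refine (mem_graph_pcomp_toPMap_top t (G : E →ₗ[A] E) x y).trans ⟨fun h => ?_, ?_⟩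
      · exact LinearPMap.mem_graph_snd_inj t h (hGT x) rfl
      · rintro (rfl : y = T x)
        exact hGT x
    rw [e, (isClosed_graph_clm T).closure_eq]

end Fredholm

/-! ### Stability of the Fredholm property -/

section Perturbation

variable {A E : Type*} [CStarAlgebra A] [PartialOrder A] [StarOrderedRing A]
  [NormedAddCommGroup E] [NormedSpace ℂ E] [Module A E] [IsScalarTower ℂ A E] [CStarModule A E]

/-- A bounded `A`-linear map satisfies a norm estimate. -/
theorem exists_bound_clm (T : E →L[A] E) : ∃ C, 0 ≤ C ∧ ∀ x, ‖T x‖ ≤ C * ‖x‖ := by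
  let T' : E →L[ℂ] E := ⟨(T : E →ₗ[A] E).restrictScalars ℂ, T.continuous⟩
  exact ⟨‖T'‖, norm_nonneg _, T'.le_opNorm⟩

/-- If `s` is `t`-compact and `G : E → E(t)` is adjointable, then `s G` is compact. -/
theorem IsRelativelyCompact.isCompactOp_comp {t s : E →ₗ.[A] E} (h : IsRelativelyCompact t s)
    {G T : E →L[A] E} (hG : IsAdjointable (G : E →ₗ[A] E)) (hT : IsAdjointable (T : E →ₗ[A] E))
    (R : E →ₗ[A] t.domain) (hRG : ∀ x, (R x : E) = G x) (hRT : ∀ x, t (R x) = T x) :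
    IsCompactOp (s.toFun ∘ₗ Submodule.inclusion h.1 ∘ₗ R) := by
  intro ε hε
  obtain ⟨G', hG'⟩ := hG
  obtain ⟨T', hT'⟩ := hT
  obtain ⟨C, hC0, hC⟩ := exists_bound_clm G
  obtain ⟨C', hC0', hC'⟩ := exists_bound_clm T
  obtain ⟨n, x, y, hn⟩ := h.exists_approx (ε := ε / (1 + C + C')) (by positivity)
  -- `y ↦ G*y + T*(t y)` is the adjoint of `G : E → E(t)`, as `tG = T`; composing with it keeps the
  -- approximants of finite rank.
  refine ⟨n, x, fun i => G' (y i) + T' (t (y i)), fun z => ?_⟩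
  have e : ∀ i, (inner A (G' (y i) + T' (t (y i))) z : A) =
      inner A (y i : E) (R z : E) + inner A (t (y i)) (t (R z)) := fun i => by
    rw [CStarModule.inner_add_left, inner_adjoint_left hG', inner_adjoint_left hT', hRG, hRT]
    rfl
  simp only [sum_rankOne_apply, e]
  refine (hn (R z)).trans ?_
  rw [hRG, hRT, div_mul_eq_mul_div, div_le_iff₀ (by positivity), mul_assoc]
  gcongr
  have := norm_nonneg z
  linarith [hC z, hC' z]

theorem IsRelativelyCompact.isFredholm_add [CompleteSpace E] {t s : E →ₗ.[A] E}
    (h : IsRelativelyCompact t s) (ht : IsSelfAdjointRegular t) (hs : IsSymmetricPMap s)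
    (htF : IsFredholm t) : IsFredholm (s + t) := by
  obtain ⟨-, G, hG, T, hT, hcl, hK⟩ := htF
  have hGT := mem_graph_of_closure_eq ht.1.closed hcl
  have hmem : ∀ x, ∃ v : t.domain, (v : E) = G x ∧ t v = T x := fun x =>
    (LinearPMap.mem_graph_iff _).1 (hGT x)
  let R : E →ₗ[A] t.domain := (G : E →ₗ[A] E).codRestrict t.domain fun x => by
    obtain ⟨v, hv, -⟩ := hmem x
    exact hv ▸ v.2
  have hRT : ∀ x, t (R x) = T x := fun x => by
    obtain ⟨v, hv, hv'⟩ := hmem x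
    rw [← hv']
    exact congrArg t (Subtype.ext hv.symm)
  have hc := h.isCompactOp_comp hG hT R (fun _ => rfl) hRT
  obtain ⟨C, -, hC⟩ := exists_bound_clm G
  obtain ⟨C₁, hC₁⟩ := hc.exists_bound
  let S : E →L[A] E := ⟨_, AddMonoidHomClass.continuous_of_bound _ _ hC₁⟩
  obtain ⟨C', -, hC'⟩ := exists_bound_clm (T + S)
  refine (hs.add ht.isSymmetricPMap).isFredholm (T := T + S) ?_ hG (hT.add hc.isAdjointable) hC hC'
    (fun x => ?_) ?_
  · rw [LinearPMap.add_domain, inf_eq_right.2 h.1]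
    exact ht.1.dense_domain
  · refine (LinearPMap.mem_graph_iff _).2 ⟨⟨R x, h.1 (R x).2, (R x).2⟩, rfl, ?_⟩
    rw [LinearPMap.add_apply, add_comm]
    exact congrArg₂ _ (hRT x) rfl
  · have e : ((T + S : E →L[A] E) : E →ₗ[A] E) - LinearMap.id =
        ((T : E →ₗ[A] E) - LinearMap.id) + s.toFun ∘ₗ Submodule.inclusion h.1 ∘ₗ R := by
      ext x
      change T x + S x - x = T x - x + S x
      abel
    rw [e]
    exact hK.add hc

end Perturbation

end HilbertCStar

theorem mainTheorem4 {A E : Type*} [CStarAlgebra A] [PartialOrder A] [StarOrderedRing A]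
    [NormedAddCommGroup E] [NormedSpace ℂ E] [CompleteSpace E]
    [Module A E] [IsScalarTower ℂ A E] [CStarModule A E]
    (hE : HilbertCStar.CountablyGenerated A E)
    (t s : E →ₗ.[A] E)
    (ht : HilbertCStar.IsSelfAdjointRegular t) (hs : HilbertCStar.IsSelfAdjointRegular s)
    (htF : HilbertCStar.IsFredholm t) (hst : HilbertCStar.IsRelativelyCompact t s) :
    HilbertCStar.IsSelfAdjointRegular (s + t) ∧ HilbertCStar.IsFredholm (s + t) :=
  ⟨hst.isSelfAdjointRegular_add ht hs.isSymmetricPMap,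
    hst.isFredholm_add ht hs.isSymmetricPMap htF⟩
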